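/- Let $\mathbb{D}^2=\{(z_1,z_2)\in\mathbb{C}^2:|z_1|<1,|z_2|<1\}$. For real $\alpha>-1$ let $A^2_\alpha(\mathbb{D}^2)$ be the weighted Bergman space of all holomorphic $f:\mathbb{D}^2\to\mathbb{C}$ with $$\|f\|_{A^2_\alpha}^2=\int_{\mathbb{D}^2}|f(z_1,z_2)|^2(1-|z_1|^2)^{\alpha}(1-|z_2|^2)^{\alpha}\,dA(z_1)\,dA(z_2)<\infty,$$ where $dA=\frac1\pi\,dx\,dy$. For a polynomial $p\in\mathbb{C}[z_1,z_2]$ of bidegree $(n,m)$ let $\tilde p(z_1,z_2)=z_1^n z_2^m\,\overline{p\left(1/\overline{z_1},1/\overline{z_2}\right)}$ be its reflection, which is again a polynomial. **Theorem.** Let $p\in\mathbb{C}[z_1,z_2]$ be a polynomial without zeros on the closed bidisc $\overline{\mathbb{D}^2}$, let $\varphi=\tilde p/p$ and $\Phi=(\varphi,\varphi)$, and suppose that $\Phi$ maps $\mathbb{D}^2$ into $\mathbb{D}^2$. Then for every $\beta>4$ the composition operator $C_\Phi f=f\circ\Phi$ is bounded from $A^2_{\frac{\beta}{2}-2}(\mathbb{D}^2)$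 to $A^2_\beta(\mathbb{D}^2)$; that is, there is a constant $C\ge 0$, depending on $p$ and $\beta$, such that for every $f\in A^2_{\frac{\beta}{2}-2}(\mathbb{D}^2)$ one has $f\circ\Phi\in A^2_\beta(\mathbb{D}^2)$ and $\|f\circ\Phi\|_{A^2_\beta}\le C\,\|f\|_{A^2_{\frac{\beta}{2}-2}}$. -/

import Mathlib

open MeasureTheory
open scoped ENNReal NNReal

namespace BidiscBergman

/-- The open unit bidisc `𝔻²` in `ℂ²`. -/
def bidisc : Set (ℂ × ℂ) := {z | ‖z.1‖ < 1 ∧ ‖z.2‖ < 1}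

/-- The closed unit bidisc in `ℂ²`. -/
def closedBidisc : Set (ℂ × ℂ) := {z | ‖z.1‖ ≤ 1 ∧ ‖z.2‖ ≤ 1}

/-- The value `p(z₁, z₂)` of a polynomial in two variables. -/
noncomputable def evalAt (p : MvPolynomial (Fin 2) ℂ) (z : ℂ × ℂ) : ℂ :=
  MvPolynomial.eval ![z.1, z.2] p

/-- `p` is stable on the closed bidisc: it has no zeros there. -/
def IsStableOnClosedBidisc (p : MvPolynomial (Fin 2) ℂ) : Prop :=
  ∀ z ∈ closedBidisc, evalAt p z ≠ 0

/-- The reflection `p̃` of a polynomial `p` of bidegree `(n, m)`: the monomial `c z₁^a z₂^b` of `p`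
contributes the monomial `conj c z₁^(n-a) z₂^(m-b)`. (Here `a ≤ n` and `b ≤ m`, so that the
subtractions are genuine; `evalAt_reflection` gives the usual formula.) -/
noncomputable def reflection (p : MvPolynomial (Fin 2) ℂ) : MvPolynomial (Fin 2) ℂ :=
  ∑ d ∈ p.support,
    MvPolynomial.C (starRingEnd ℂ (p.coeff d)) *
      MvPolynomial.X 0 ^ (p.degreeOf 0 - d 0) * MvPolynomial.X 1 ^ (p.degreeOf 1 - d 1)

/-- `p̃(z) = z₁^n z₂^m conj (p (1 / conj z₁, 1 / conj z₂))`, where `(n, m)` is the bidegree of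
`p`. -/
theorem evalAt_reflection (p : MvPolynomial (Fin 2) ℂ) (z : ℂ × ℂ) (h₁ : z.1 ≠ 0) (h₂ : z.2 ≠ 0) :
    evalAt (reflection p) z = z.1 ^ p.degreeOf 0 * z.2 ^ p.degreeOf 1 *
      starRingEnd ℂ (evalAt p (1 / starRingEnd ℂ z.1, 1 / starRingEnd ℂ z.2)) := by
  have key : ∀ d ∈ p.support, d 0 ≤ p.degreeOf 0 ∧ d 1 ≤ p.degreeOf 1 := fun d hd =>
    ⟨MvPolynomial.monomial_le_degreeOf 0 hd, MvPolynomial.monomial_le_degreeOf 1 hd⟩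
  simp only [evalAt, reflection, map_sum, MvPolynomial.eval_eq' _ p, Finset.mul_sum]
  refine Finset.sum_congr rfl fun d hd => ?_
  obtain ⟨ha, hb⟩ := key d hd
  simp only [map_mul, map_pow, MvPolynomial.eval_C, MvPolynomial.eval_X, Fin.prod_univ_two,
    Matrix.cons_val_zero, Matrix.cons_val_one, map_div₀, map_one, Complex.conj_conj]
  rw [pow_sub₀ _ h₁ ha, pow_sub₀ _ h₂ hb]
  simp only [one_div, inv_pow]
  ring

/-- The rational function `φ = p̃ / p`. -/
noncomputable def rif (p : MvPolynomial (Fin 2) ℂ) (z : ℂ × ℂ) : ℂ :=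
  evalAt (reflection p) z / evalAt p z

/-- The symbol `Φ = (φ, φ)` with `φ = p̃ / p`. -/
noncomputable def symbol (p : MvPolynomial (Fin 2) ℂ) (z : ℂ × ℂ) : ℂ × ℂ :=
  (rif p z, rif p z)

/-- Normalised area measure `dA = dx dy / π` on `ℂ`. -/
noncomputable def normalisedArea : Measure ℂ :=
  ENNReal.ofReal (1 / Real.pi) • (volume : Measure ℂ)

/-- The measure `(1 - |z₁|²)^β (1 - |z₂|²)^β dA(z₁) dA(z₂)` on the bidisc, extended by zero to
`ℂ²`. -/
noncomputable def weightedVolume (β : ℝ) : Measure (ℂ × ℂ) :=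
  ((normalisedArea.prod normalisedArea).restrict bidisc).withDensity fun z =>
    ENNReal.ofReal ((1 - ‖z.1‖ ^ 2) ^ β * (1 - ‖z.2‖ ^ 2) ^ β)

/-- The weighted Bergman space `A²_β(𝔻²)`: functions that are holomorphic on the bidisc and square
integrable there for the weighted volume. Functions are written as total functions on `ℂ²`; neither
membership nor the norm depends on their values outside the bidisc. -/
noncomputable def bergmanSpace (β : ℝ) : Submodule ℂ (ℂ × ℂ → ℂ) where
  carrier := {f | DifferentiableOn ℂ f bidisc ∧ MemLp f 2 (weightedVolume β)}
  add_mem' hf hg := ⟨hf.1.add hg.1, hf.2.add hg.2⟩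
  zero_mem' := ⟨differentiableOn_const 0, MemLp.zero⟩
  smul_mem' c _ hf := ⟨hf.1.const_smul c, hf.2.const_smul c⟩

/-- The norm of `A²_β(𝔻²)`, i.e. `(∫ |f|² (1 - |z₁|²)^β (1 - |z₂|²)^β dA dA)^(1/2)`, with values in
`[0, ∞]`; it is finite on `bergmanSpace β`. -/
noncomputable def bergmanNorm (β : ℝ) (f : ℂ × ℂ → ℂ) : ℝ≥0∞ :=
  eLpNorm f 2 (weightedVolume β)

/-- The composition operator `f ↦ f ∘ Φ` is well defined and bounded from `A²_α(𝔻²)` to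
`A²_β(𝔻²)`. -/
def IsBoundedCompositionOperator (α β : ℝ) (Φ : ℂ × ℂ → ℂ × ℂ) : Prop :=
  ∃ C : ℝ≥0, ∀ f ∈ bergmanSpace α,
    f ∘ Φ ∈ bergmanSpace β ∧ bergmanNorm β (f ∘ Φ) ≤ C * bergmanNorm α f

end BidiscBergman

namespace BidiscBergman

open Metric Set Real
open scoped ComplexConjugate

/-! A pointwise estimate suffices. The sub-mean value property of `|f|²` on a polydisc centred at
`w`, of half the distance to the boundary, gives `|f(w)|² ≤ C ‖f‖² ((1 - |w₁|)(1 - |w₂|))^(-(α+2))`.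
At `w = (φ(z), φ(z))` the bound becomes `(1 - |φ(z)|)^(-(2α+4))`. Schwarz–Pick in each variable
gives `(1 - |z₁|²)(1 - |z₂|²) ≤ C (1 - |φ(z)|)`, so the weight with exponent `β = 2α + 4` absorbs
this growth exactly. The weighted integrand is thus at most `C ‖f‖²`, and the bidisc has finite
measure. -/

/-! ### Schwarz–Pick in the disc -/

/-- A form of the Schwarz–Pick inequality: a holomorphic self-map of the unit disc approaches the
unit circle at most linearly. -/
theorem one_sub_norm_sq_schwarzPick {g : ℂ → ℂ} (hg : DifferentiableOn ℂ g (ball 0 1))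
    (hm : MapsTo g (ball 0 1) (ball 0 1)) {z : ℂ} (hz : ‖z‖ < 1) :
    (1 - ‖z‖ ^ 2) * (1 - ‖g 0‖ ^ 2) / 4 ≤ 1 - ‖g z‖ ^ 2 := by
  set a := g 0
  have ha : ‖a‖ < 1 := by simpa using hm (mem_ball_self one_pos)
  have hlow : ∀ w : ℂ, ‖w‖ < 1 → 1 - ‖a‖ ≤ ‖1 - conj a * w‖ := fun w hw => by
    have h1 : ‖(1 : ℂ)‖ - ‖conj a * w‖ ≤ ‖1 - conj a * w‖ := norm_sub_norm_le _ _
    rw [norm_one, norm_mul, Complex.norm_conj] at h1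
    nlinarith [norm_nonneg a, norm_nonneg w]
  have hne : ∀ w : ℂ, ‖w‖ < 1 → 1 - conj a * w ≠ 0 := fun w hw h => by
    have := hlow w hw
    rw [h, norm_zero] at this
    linarith
  -- This identity shows that the Möbius map sending `a` to `0` preserves the disc; it also turns
  -- the Schwarz bound into one on `1 - ‖g z‖ ^ 2`.
  have hident : ∀ w : ℂ, ‖1 - conj a * w‖ ^ 2 - ‖w - a‖ ^ 2 = (1 - ‖a‖ ^ 2) * (1 - ‖w‖ ^ 2) :=
    fun w => by
      simp only [Complex.sq_norm, Complex.normSq_apply, Complex.sub_re, Complex.sub_im,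
        Complex.mul_re, Complex.mul_im, Complex.conj_re, Complex.conj_im, Complex.one_re,
        Complex.one_im]
      ring
  have hgz : ∀ w : ℂ, ‖w‖ < 1 → ‖g w‖ < 1 := fun w hw => by
    simpa using hm (show w ∈ ball (0 : ℂ) 1 by simpa using hw)
  -- Schwarz lemma for `g` followed by that Möbius map, which vanishes at `0`.
  have hS : ‖(g z - a) / (1 - conj a * g z)‖ ≤ ‖z‖ := by
    refine Complex.norm_le_norm_of_mapsTo_ball (f := fun w => (g w - a) / (1 - conj a * g w))
      (R := 1) ?_ ?_ (by simp [a]) hz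
    · refine (hg.sub_const a).div ((hg.const_mul (conj a)).const_sub 1) fun w hw => hne _ ?_
      exact hgz w (by simpa using hw)
    · intro w hw
      have hw' := hgz w (by simpa using hw)
      have hpos := norm_pos_iff.2 (hne _ hw')
      rw [mem_closedBall_zero_iff, norm_div, div_le_one hpos]
      refine le_of_sq_le_sq ?_ hpos.le
      have := hident (g w)
      nlinarith [mul_nonneg (show 0 ≤ 1 - ‖a‖ ^ 2 by nlinarith [norm_nonneg a])
        (show 0 ≤ 1 - ‖g w‖ ^ 2 by nlinarith [norm_nonneg (g w)])]
  have hpos := norm_pos_iff.2 (hne _ (hgz z hz))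
  rw [norm_div, div_le_iff₀ hpos] at hS
  have h1 : ‖g z - a‖ ^ 2 ≤ ‖z‖ ^ 2 * ‖1 - conj a * g z‖ ^ 2 := by
    rw [← mul_pow]; exact pow_le_pow_left₀ (norm_nonneg _) hS 2
  have h2 := hident (g z)
  have h3 := pow_le_pow_left₀ (by linarith) (hlow _ (hgz z hz)) 2
  have h4 : (1 - ‖z‖ ^ 2) * (1 - ‖a‖) ^ 2 ≤ (1 - ‖a‖ ^ 2) * (1 - ‖g z‖ ^ 2) := by
    have := mul_le_mul_of_nonneg_left h3 (show 0 ≤ 1 - ‖z‖ ^ 2 by nlinarith [norm_nonneg z])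
    linarith
  have h5 : (1 - ‖z‖ ^ 2) * (1 - ‖a‖) ≤ (1 + ‖a‖) * (1 - ‖g z‖ ^ 2) := by
    refine le_of_mul_le_mul_left ?_ (show 0 < 1 - ‖a‖ by linarith)
    linarith
  have h6 : (1 - ‖z‖ ^ 2) * (1 - ‖a‖) * (1 + ‖a‖) ≤ (1 + ‖a‖) * (1 - ‖g z‖ ^ 2) * (1 + ‖a‖) :=
    mul_le_mul_of_nonneg_right h5 (by positivity)
  have h7 : 0 ≤ 1 - ‖g z‖ ^ 2 := by nlinarith [norm_nonneg (g z), hgz z hz]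
  -- The constant 4 comes from `(1 + ‖a‖) ^ 2 ≤ 4`.
  nlinarith [mul_nonneg (show 0 ≤ 4 - (1 + ‖a‖) ^ 2 by nlinarith [norm_nonneg a]) h7]

/-! ### Sub-mean value inequalities -/

/-- The sub-mean value property of `‖g‖` on circles, as a lower integral. -/
theorem enorm_mul_two_pi_le_lintegral_circle {g : ℂ → ℂ} {c : ℂ} {r ρ : ℝ}
    (hg : DifferentiableOn ℂ g (ball c r)) (h0 : 0 < ρ) (hρ : ρ < r) :
    ‖g c‖ₑ * ENNReal.ofReal (2 * π) ≤ ∫⁻ θ in Ioo (-π) π, ‖g (circleMap c ρ θ)‖ₑ := by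
  have hd : DiffContOnCl ℂ g (ball c |ρ|) := by
    rw [abs_of_pos h0]
    exact (hg.mono (closedBall_subset_ball hρ)).diffContOnCl_ball subset_rfl
  have h1 : (∫ θ in (-π)..π, g (circleMap c ρ θ)) = (2 * π : ℝ) • g c := by
    have h2 := hd.circleAverage
    rw [circleAverage_def] at h2
    -- Circle averages use angles in `(0, 2π)`, polar coordinates use `(-π, π)`; periodicity
    -- reconciles them.
    have h3 := ((periodic_circleMap c ρ).comp g).intervalIntegral_add_eq (-π) 0
    rw [show -π + 2 * π = π by ring, zero_add] at h3
    simp only [Function.comp_apply] at h3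
    rw [h3, ← h2, smul_smul, mul_inv_cancel₀ (by positivity), one_smul]
  rw [intervalIntegral.integral_of_le (by linarith [pi_pos]), integral_Ioc_eq_integral_Ioo] at h1
  have h4 := enorm_integral_le_lintegral_enorm (μ := volume.restrict (Ioo (-π) π))
    fun θ => g (circleMap c ρ θ)
  rw [h1, enorm_smul, Real.enorm_of_nonneg (by positivity), mul_comm] at h4
  exact h4

/-- The sub-mean value property of `‖g‖` on discs. -/
theorem enorm_mul_sq_le_lintegral_ball {g : ℂ → ℂ} {c : ℂ} {r : ℝ} (hr : 0 < r)
    (hg : DifferentiableOn ℂ g (ball c r)) :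
    ‖g c‖ₑ * ENNReal.ofReal (r ^ 2) ≤ ∫⁻ z in ball c r, ‖g z‖ₑ ∂normalisedArea := by
  -- Extension by zero makes the integrand measurable on all of `ℂ`, as polar coordinates require.
  set F : ℂ → ℝ≥0∞ := (ball c r).indicator fun z => ‖g z‖ₑ
  have hF : Measurable F := by
    classical
    rw [show F = (ball c r).piecewise (fun z => ‖g z‖ₑ) 0 from
      (Set.piecewise_eq_indicator ..).symm]
    exact hg.continuousOn.enorm.measurable_piecewise continuousOn_const measurableSet_ball
  have key : ‖g c‖ₑ * ENNReal.ofReal (π * r ^ 2) ≤ ∫⁻ z in ball c r, ‖g z‖ₑ := by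
    rw [← lintegral_indicator measurableSet_ball]
    change _ ≤ ∫⁻ z, F z
    rw [← lintegral_add_left_eq_self F c, ← Complex.lintegral_comp_polarCoord_symm]
    have hsub : Ioo 0 r ×ˢ Ioo (-π) π ⊆ polarCoord.target :=
      prod_mono (fun _ h => h.1) subset_rfl
    refine le_trans ?_ (lintegral_mono_set hsub)
    have hG : Measurable fun p : ℝ × ℝ =>
        ENNReal.ofReal p.1 • F (c + Complex.polarCoord.symm p) := by
      simp only [Complex.polarCoord_symm_apply]
      fun_prop
    rw [Measure.volume_eq_prod, ← Measure.prod_restrict, lintegral_prod _ hG.aemeasurable]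
    have hI : ∫⁻ ρ in Ioo 0 r, ENNReal.ofReal ρ = ENNReal.ofReal (r ^ 2 / 2) := by
      rw [← ofReal_integral_eq_lintegral_ofReal, ← integral_Ioc_eq_integral_Ioo,
        ← intervalIntegral.integral_of_le hr.le, integral_id]
      · simp
      · exact (continuous_id.integrableOn_Icc (a := 0) (b := r)).mono_set Ioo_subset_Icc_self
      · exact (ae_restrict_mem measurableSet_Ioo).mono fun x hx => hx.1.le
    calc ‖g c‖ₑ * ENNReal.ofReal (π * r ^ 2)
        = (∫⁻ ρ in Ioo 0 r, ENNReal.ofReal ρ) * (‖g c‖ₑ * ENNReal.ofReal (2 * π)) := by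
          rw [hI, mul_left_comm, ← ENNReal.ofReal_mul (by positivity)]
          congr 2; ring
      _ = ∫⁻ ρ in Ioo 0 r, ENNReal.ofReal ρ * (‖g c‖ₑ * ENNReal.ofReal (2 * π)) :=
          (lintegral_mul_const _ ENNReal.measurable_ofReal).symm
      _ ≤ _ := by
          refine setLIntegral_mono' measurableSet_Ioo fun ρ hρ => ?_
          simp only [smul_eq_mul]
          rw [lintegral_const_mul _ (by
            simp only [Complex.polarCoord_symm_apply]
            fun_prop)]
          gcongr
          refine (enorm_mul_two_pi_le_lintegral_circle hg hρ.1 hρ.2).trans_eq ?_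
          refine lintegral_congr fun θ => ?_
          have hc : c + Complex.polarCoord.symm (ρ, θ) = circleMap c ρ θ := by
            rw [Complex.polarCoord_symm_apply, circleMap, Complex.exp_mul_I]
            simp
          have hmem : circleMap c ρ θ ∈ ball c r := by
            rw [mem_ball, dist_eq_norm, circleMap_sub_center]
            simpa [abs_of_pos hρ.1] using hρ.2
          rw [hc]
          exact (indicator_of_mem hmem fun z => ‖g z‖ₑ).symm
  rw [normalisedArea, Measure.restrict_smul, lintegral_smul_measure, smul_eq_mul]
  calc ‖g c‖ₑ * ENNReal.ofReal (r ^ 2)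
      = ENNReal.ofReal (1 / π) * (‖g c‖ₑ * ENNReal.ofReal (π * r ^ 2)) := by
        rw [mul_left_comm, ← ENNReal.ofReal_mul (by positivity)]
        congr 2
        field_simp
    _ ≤ _ := by gcongr

/-! ### Point evaluations on the Bergman space -/

theorem bidisc_eq_prod : bidisc = ball (0 : ℂ) 1 ×ˢ ball (0 : ℂ) 1 := by
  ext z
  simp [bidisc]

theorem isOpen_bidisc : IsOpen bidisc := by
  rw [bidisc_eq_prod]
  exact isOpen_ball.prod isOpen_ball

instance : IsFiniteMeasureOnCompacts normalisedArea :=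
  IsFiniteMeasureOnCompacts.smul _ ENNReal.ofReal_ne_top

instance : SFinite normalisedArea :=
  inferInstanceAs (SFinite (ENNReal.ofReal (1 / π) • (volume : Measure ℂ)))

/-- Since the density is finite, `h` need not be measurable; elements of the space are arbitrary off
the bidisc. -/
theorem lintegral_weightedVolume (α : ℝ) (h : ℂ × ℂ → ℝ≥0∞) :
    ∫⁻ z, h z ∂weightedVolume α = ∫⁻ z in bidisc,
      ENNReal.ofReal ((1 - ‖z.1‖ ^ 2) ^ α * (1 - ‖z.2‖ ^ 2) ^ α) * h z
        ∂normalisedArea.prod normalisedArea := by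
  rw [weightedVolume, lintegral_withDensity_eq_lintegral_mul_non_measurable]
  · rfl
  · measurability
  · exact ae_of_all _ fun z => ENNReal.ofReal_lt_top

theorem differentiableOn_slice_left {f : ℂ × ℂ → ℂ} {s t : Set ℂ}
    (hf : DifferentiableOn ℂ f (s ×ˢ t)) {w : ℂ} (hw : w ∈ t) :
    DifferentiableOn ℂ (fun z => f (z, w)) s :=
  hf.comp (f := fun z : ℂ => (z, w)) (by fun_prop) fun _ hz => ⟨hz, hw⟩

theorem differentiableOn_slice_right {f : ℂ × ℂ → ℂ} {s t : Set ℂ}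
    (hf : DifferentiableOn ℂ f (s ×ˢ t)) {w : ℂ} (hw : w ∈ s) :
    DifferentiableOn ℂ (fun z => f (w, z)) t :=
  hf.comp (f := fun z : ℂ => (w, z)) (by fun_prop) fun _ hz => ⟨hw, hz⟩

/-- The sub-mean value property of `‖g‖` on polydiscs. -/
theorem enorm_mul_le_lintegral_polydisc {g : ℂ × ℂ → ℂ} {c : ℂ × ℂ} {r s : ℝ} (hr : 0 < r)
    (hs : 0 < s) (hg : DifferentiableOn ℂ g (ball c.1 r ×ˢ ball c.2 s)) :
    ‖g c‖ₑ * ENNReal.ofReal (r ^ 2) * ENNReal.ofReal (s ^ 2) ≤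
      ∫⁻ z in ball c.1 r ×ˢ ball c.2 s, ‖g z‖ₑ ∂normalisedArea.prod normalisedArea := by
  have hmeas : AEMeasurable (fun z => ‖g z‖ₑ)
      ((normalisedArea.restrict (ball c.1 r)).prod (normalisedArea.restrict (ball c.2 s))) := by
    rw [Measure.prod_restrict]
    exact hg.continuousOn.enorm.aemeasurable (measurableSet_ball.prod measurableSet_ball)
  rw [← Measure.prod_restrict, lintegral_prod _ hmeas]
  calc ‖g c‖ₑ * ENNReal.ofReal (r ^ 2) * ENNReal.ofReal (s ^ 2)
      ≤ (∫⁻ z in ball c.1 r, ‖g (z, c.2)‖ₑ ∂normalisedArea) * ENNReal.ofReal (s ^ 2) := by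
        gcongr
        exact enorm_mul_sq_le_lintegral_ball hr
          (differentiableOn_slice_left hg (mem_ball_self hs))
    _ = ∫⁻ z in ball c.1 r, ‖g (z, c.2)‖ₑ * ENNReal.ofReal (s ^ 2) ∂normalisedArea :=
        (lintegral_mul_const' _ _ ENNReal.ofReal_ne_top).symm
    _ ≤ _ := setLIntegral_mono' measurableSet_ball fun z hz =>
        enorm_mul_sq_le_lintegral_ball hs (differentiableOn_slice_right hg hz)

/-- Point evaluations on the weighted Bergman space are bounded, with the usual growth rate. -/
theorem enorm_sq_mul_le_lintegral {f : ℂ × ℂ → ℂ} (hf : DifferentiableOn ℂ f bidisc) {α : ℝ}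
    (hα : 0 ≤ α) {w : ℂ × ℂ} (hw : w ∈ bidisc) :
    ‖f w‖ₑ ^ 2 * ENNReal.ofReal (((1 - ‖w.1‖) / 2 * ((1 - ‖w.2‖) / 2)) ^ (α + 2)) ≤
      ∫⁻ z, ‖f z‖ₑ ^ 2 ∂weightedVolume α := by
  set r := (1 - ‖w.1‖) / 2 with hr_def
  set s := (1 - ‖w.2‖) / 2 with hs_def
  have hr : 0 < r := by have := hw.1; rw [hr_def]; linarith
  have hs : 0 < s := by have := hw.2; rw [hs_def]; linarith
  -- Halving the distance keeps the polydisc inside the bidisc and, as `α ≥ 0`, the weight on it at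
  -- least `(r * s) ^ α`.
  have hbound : ∀ c z : ℂ, z ∈ ball c ((1 - ‖c‖) / 2) → (1 - ‖c‖) / 2 ≤ 1 - ‖z‖ := by
    intro c z hz
    rw [mem_ball, dist_eq_norm] at hz
    have := norm_sub_norm_le z c
    linarith
  have hsub : ball w.1 r ×ˢ ball w.2 s ⊆ bidisc := by
    rintro z ⟨h1, h2⟩
    have := hbound _ _ h1
    have := hbound _ _ h2
    constructor <;> linarith
  have hmv := enorm_mul_le_lintegral_polydisc hr hs (g := fun z => f z ^ 2)
    ((hf.mono hsub).pow 2)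
  simp only [enorm_pow] at hmv
  rw [lintegral_weightedVolume]
  calc ‖f w‖ₑ ^ 2 * ENNReal.ofReal ((r * s) ^ (α + 2))
      = ENNReal.ofReal ((r * s) ^ α) *
          (‖f w‖ₑ ^ 2 * ENNReal.ofReal (r ^ 2) * ENNReal.ofReal (s ^ 2)) := by
        rw [rpow_add (by positivity), rpow_two, mul_pow, ENNReal.ofReal_mul (by positivity),
          ENNReal.ofReal_mul (by positivity)]
        ring
    _ ≤ ENNReal.ofReal ((r * s) ^ α) * ∫⁻ z in ball w.1 r ×ˢ ball w.2 s, ‖f z‖ₑ ^ 2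
          ∂normalisedArea.prod normalisedArea := by gcongr
    _ = ∫⁻ z in ball w.1 r ×ˢ ball w.2 s, ENNReal.ofReal ((r * s) ^ α) * ‖f z‖ₑ ^ 2
          ∂normalisedArea.prod normalisedArea :=
        (lintegral_const_mul' _ _ ENNReal.ofReal_ne_top).symm
    _ ≤ ∫⁻ z in ball w.1 r ×ˢ ball w.2 s,
          ENNReal.ofReal ((1 - ‖z.1‖ ^ 2) ^ α * (1 - ‖z.2‖ ^ 2) ^ α) * ‖f z‖ₑ ^ 2
          ∂normalisedArea.prod normalisedArea := by
        refine setLIntegral_mono' (measurableSet_ball.prod measurableSet_ball) fun z hz => ?_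
        have h1 := hbound _ _ hz.1
        have h2 := hbound _ _ hz.2
        have h3 : r ≤ 1 - ‖z.1‖ ^ 2 := by nlinarith [norm_nonneg z.1]
        have h4 : s ≤ 1 - ‖z.2‖ ^ 2 := by nlinarith [norm_nonneg z.2]
        have h5 : 0 ≤ (1 - ‖z.1‖ ^ 2) ^ α := rpow_nonneg (hr.le.trans h3) α
        rw [mul_rpow hr.le hs.le]
        gcongr
    _ ≤ _ := lintegral_mono_set hsub

/-- A holomorphic map of the bidisc into the disc approaches the unit circle at most as fast as the
product of the distances to the two boundary faces. -/
theorem one_sub_norm_sq_schwarzPick_bidisc {g : ℂ × ℂ → ℂ} (hg : DifferentiableOn ℂ g bidisc)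
    (hm : MapsTo g bidisc (ball 0 1)) {z : ℂ × ℂ} (hz : z ∈ bidisc) :
    (1 - ‖z.1‖ ^ 2) * (1 - ‖z.2‖ ^ 2) * (1 - ‖g 0‖ ^ 2) / 16 ≤ 1 - ‖g z‖ ^ 2 := by
  rw [bidisc_eq_prod] at hg hm
  have h0 : (0 : ℂ) ∈ ball (0 : ℂ) 1 := mem_ball_self one_pos
  have hz2 : z.2 ∈ ball (0 : ℂ) 1 := by simpa using hz.2
  -- Move from `(0, 0)` to `(0, z.2)` (`h2`), then to `z` (`h1`); each move costs a factor 4.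
  have h1 := one_sub_norm_sq_schwarzPick (differentiableOn_slice_left hg hz2)
    (fun x hx => hm ⟨hx, hz2⟩) hz.1
  have h2 := one_sub_norm_sq_schwarzPick (differentiableOn_slice_right hg h0)
    (fun x hx => hm ⟨h0, hx⟩) hz.2
  have h3 : 0 ≤ 1 - ‖z.1‖ ^ 2 := by nlinarith [norm_nonneg z.1, hz.1]
  have h4 := mul_le_mul_of_nonneg_left h2 h3
  simp only [Prod.mk_zero_zero] at h1 h4
  linarith

theorem differentiable_evalAt (p : MvPolynomial (Fin 2) ℂ) : Differentiable ℂ (evalAt p) := by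
  unfold evalAt
  simp only [MvPolynomial.eval_eq', Fin.prod_univ_two, Matrix.cons_val_zero, Matrix.cons_val_one]
  fun_prop

theorem differentiableOn_rif {p : MvPolynomial (Fin 2) ℂ} (hp : IsStableOnClosedBidisc p) :
    DifferentiableOn ℂ (rif p) bidisc := by
  simp only [funext fun z => div_eq_mul_inv (evalAt (reflection p) z) (evalAt p z),
    show rif p = fun z => evalAt (reflection p) z / evalAt p z from rfl]
  exact (differentiable_evalAt _).differentiableOn.mul
    ((differentiable_evalAt _).differentiableOn.inv fun z hz => hp z ⟨hz.1.le, hz.2.le⟩)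

/-! ### Boundedness of the composition operator -/

theorem eLpNorm_two_sq_eq_lintegral {f : ℂ × ℂ → ℂ} (μ : Measure (ℂ × ℂ)) :
    eLpNorm f 2 μ ^ 2 = ∫⁻ z, ‖f z‖ₑ ^ 2 ∂μ := by
  simpa using eLpNorm_nnreal_pow_eq_lintegral (μ := μ) (f := f) (p := 2) two_ne_zero

theorem measure_bidisc_lt_top : (normalisedArea.prod normalisedArea) bidisc < ∞ := by
  rw [bidisc_eq_prod, Measure.prod_prod]
  exact ENNReal.mul_lt_top measure_ball_lt_top measure_ball_lt_top

/-- Composition with `(g, g)`, for a holomorphic map `g` of the bidisc into the disc, is bounded from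
`A²_α` to `A²_{2α+4}`. -/
theorem isBoundedCompositionOperator_diagonal {g : ℂ × ℂ → ℂ} (hg : DifferentiableOn ℂ g bidisc)
    (hm : MapsTo g bidisc (ball 0 1)) {α : ℝ} (hα : 0 ≤ α) :
    IsBoundedCompositionOperator α (2 * α + 4) fun z => (g z, g z) := by
  set δ := 1 - ‖g 0‖ ^ 2 with hδ_def
  have hδ : 0 < δ := by
    have : ‖g 0‖ < 1 := by simpa using hm (show (0 : ℂ × ℂ) ∈ bidisc by simp [bidisc])
    nlinarith [norm_nonneg (g 0)]
  set K : ℝ≥0∞ := ENNReal.ofReal ((64 / δ) ^ (2 * α + 4)) *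
    (normalisedArea.prod normalisedArea) bidisc
  have hK : K < ∞ := ENNReal.mul_lt_top ENNReal.ofReal_lt_top measure_bidisc_lt_top
  have hmaps : MapsTo (fun z => (g z, g z)) bidisc bidisc := fun z hz => by
    have := hm hz
    exact ⟨by simpa using this, by simpa using this⟩
  have main : ∀ f : ℂ × ℂ → ℂ, DifferentiableOn ℂ f bidisc →
      bergmanNorm (2 * α + 4) (f ∘ fun z => (g z, g z)) ≤
        (NNReal.sqrt K.toNNReal : ℝ≥0) * bergmanNorm α f := by
    intro f hf
    rw [← ENNReal.pow_le_pow_left_iff two_ne_zero, mul_pow, ← ENNReal.coe_pow, NNReal.sq_sqrt,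
      ENNReal.coe_toNNReal hK.ne, bergmanNorm, bergmanNorm, eLpNorm_two_sq_eq_lintegral,
      eLpNorm_two_sq_eq_lintegral, lintegral_weightedVolume]
    set N := ∫⁻ z, ‖f z‖ₑ ^ 2 ∂weightedVolume α
    calc _ ≤ ∫⁻ z in bidisc, ENNReal.ofReal ((64 / δ) ^ (2 * α + 4)) * N
              ∂normalisedArea.prod normalisedArea := by
          refine setLIntegral_mono' isOpen_bidisc.measurableSet fun z hz => ?_
          have hsp := one_sub_norm_sq_schwarzPick_bidisc hg hm hz
          have hgz : ‖g z‖ < 1 := (hmaps hz).1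
          have hpt := enorm_sq_mul_le_lintegral hf hα (hmaps hz)
          have h1 : 0 ≤ 1 - ‖z.1‖ ^ 2 := by nlinarith [norm_nonneg z.1, hz.1]
          have h2 : 0 ≤ 1 - ‖z.2‖ ^ 2 := by nlinarith [norm_nonneg z.2, hz.2]
          have hr : 0 ≤ (1 - ‖g z‖) / 2 := by linarith
          -- 64 is the 16 of Schwarz–Pick times 4, from `1 - ‖g z‖ ^ 2 ≤ 4 * ((1 - ‖g z‖) / 2)`.
          have hle : (1 - ‖z.1‖ ^ 2) * (1 - ‖z.2‖ ^ 2) ≤ 64 / δ * ((1 - ‖g z‖) / 2) := by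
            rw [div_mul_eq_mul_div, le_div_iff₀ hδ]
            nlinarith [norm_nonneg (g z)]
          have hw : (1 - ‖z.1‖ ^ 2) ^ (2 * α + 4) * (1 - ‖z.2‖ ^ 2) ^ (2 * α + 4) ≤
              (64 / δ) ^ (2 * α + 4) * ((1 - ‖g z‖) / 2 * ((1 - ‖g z‖) / 2)) ^ (α + 2) := by
            rw [← mul_rpow h1 h2, ← sq, ← rpow_natCast ((1 - ‖g z‖) / 2) 2, ← rpow_mul hr, Nat.cast_ofNat,
              show 2 * (α + 2) = 2 * α + 4 by ring, ← mul_rpow (by positivity) hr]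
            exact rpow_le_rpow (by positivity) hle (by positivity)
          calc _ ≤ ENNReal.ofReal ((64 / δ) ^ (2 * α + 4) *
                  ((1 - ‖g z‖) / 2 * ((1 - ‖g z‖) / 2)) ^ (α + 2)) * ‖f (g z, g z)‖ₑ ^ 2 := by
                simp only [Function.comp_apply]
                gcongr
            _ = ENNReal.ofReal ((64 / δ) ^ (2 * α + 4)) * (‖f (g z, g z)‖ₑ ^ 2 *
                  ENNReal.ofReal (((1 - ‖g z‖) / 2 * ((1 - ‖g z‖) / 2)) ^ (α + 2))) := by
                rw [ENNReal.ofReal_mul (by positivity)]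
                ring
            _ ≤ _ := by gcongr
      _ = K * N := by
          rw [setLIntegral_const]
          ring
  refine ⟨NNReal.sqrt K.toNNReal, fun f hf => ⟨⟨?_, ?_, ?_⟩, main f hf.1⟩⟩
  · exact hf.1.comp (hg.prodMk hg) hmaps
  · exact ((hf.1.comp (hg.prodMk hg) hmaps).continuousOn.aestronglyMeasurable
      isOpen_bidisc.measurableSet).mono_ac (withDensity_absolutelyContinuous _ _)
  · exact (main f hf.1).trans_lt (ENNReal.mul_lt_top ENNReal.coe_lt_top hf.2.2)

end BidiscBergman

theorem theorem2p2 (p : MvPolynomial (Fin 2) ℂ)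
    (hp : BidiscBergman.IsStableOnClosedBidisc p)
    (hΦ : Set.MapsTo (BidiscBergman.symbol p) BidiscBergman.bidisc BidiscBergman.bidisc)
    (β : ℝ) (hβ : 4 < β) :
    BidiscBergman.IsBoundedCompositionOperator (β / 2 - 2) β (BidiscBergman.symbol p) := by
  -- The assumption `4 < β` supplies `α ≥ 0`.
  have h := BidiscBergman.isBoundedCompositionOperator_diagonal (α := β / 2 - 2)
    (BidiscBergman.differentiableOn_rif hp)
    (fun z hz => mem_ball_zero_iff.2 (hΦ hz).1) (by linarith)
  rwa [show 2 * (β / 2 - 2) + 4 = β by ring] at h
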